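/- Let $k$ be an arbitrary field, $n\ge 1$, and $R=k[X_0,\dots,X_n]$. Let $\mathfrak F:\mathbb P^n_k\dashrightarrow\mathbb P^n_k$ be a Cremona map, that is, a birational map of $\mathbb P^n_k$ onto itself, represented by forms $\mathbf f=(f_0,\dots,f_n)$ of the same degree $\geq 1$ in $R$, not all zero, and let $I=(f_0,\dots,f_n)\subset R$ be its base ideal. (Two tuples of forms represent the same map when they are proportional by a ratio of nonzero forms.) Let $\mathcal J$ be the kernel of the surjection $R[Y_0,\dots,Y_n]\to\mathcal R_R(I)=\bigoplus_{q\ge 0}I^qt^q$, $Y_j\mapsto f_jt$, of $R$-algebras; it is a bihomogeneous ideal of $k[X_0,\dots,X_n,Y_0,\dots,Y_n]$, and $\mathcal J_{1,q}$ denotes its piece of bidegree $(1,q)$ (degree $1$ in $X$ and degree $q$ in $Y$). The semilinear generation degree $\mathrm{sgd}(I)$ is the least integer $s\ge 1$ such that the ideal generated by $\bigcup_{q\ge 0}\mathcal J_{1,q}$ equals the ideal generated by $\bigcup_{q\le s}\mathcal J_{1,q}$. Let $\deg(\mathfrak F^{-1})$ denote the degree of the inverse map, i.e. the common degree of the forms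 in a tuple that represents $\mathfrak F^{-1}$ and generates an ideal of codimension at least $2$. Then $$\mathrm{sgd}(I)\;\ge\;\frac{\deg(\mathfrak F^{-1})}{n}.$$ -/

import Mathlib

open MvPolynomial

noncomputable section

namespace Cremona

/-- The base ideal `(f_0, …, f_m)` of a tuple of elements. -/
def baseIdeal {R ι : Type*} [CommRing R] (f : ι → R) : Ideal R :=
  Ideal.span (Set.range f)

/-- `f = (f_0, …, f_m)` represents a rational map `ℙⁿ ⇢ ℙᵐ` over `k` by forms of degree `d`:
the `f_j` are forms of the same degree `d ≥ 1` which generate a nonzero ideal. (As `k[X]` is a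
domain, it is automatically torsionfree over `k[f]`, and its only minimal prime is zero.) -/
structure IsRationalDatum {k : Type*} [Field k] {n m : ℕ} (d : ℕ)
    (f : Fin (m + 1) → MvPolynomial (Fin (n + 1)) k) : Prop where
  one_le : 1 ≤ d
  homogeneous : ∀ j, (f j).IsHomogeneous d
  baseIdeal_ne_bot : baseIdeal f ≠ ⊥

/-- Two tuples of forms are equivalent (represent the same rational map) if they are proportional
by a ratio of nonzero forms. -/
def EquivTuple {k : Type*} [Field k] {n m : ℕ}
    (f f' : Fin (m + 1) → MvPolynomial (Fin (n + 1)) k) : Prop :=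
  ∃ (F F' : MvPolynomial (Fin (n + 1)) k) (a a' : ℕ),
    F ≠ 0 ∧ F' ≠ 0 ∧ F.IsHomogeneous a ∧ F'.IsHomogeneous a' ∧ ∀ j, F * f' j = F' * f j

/-- The homogeneous ideal of the image of the rational map given by `f`: the ideal of all
polynomial relations of `f` over `k`. -/
def imageIdeal {k : Type*} [Field k] {n m : ℕ}
    (f : Fin (m + 1) → MvPolynomial (Fin (n + 1)) k) : Ideal (MvPolynomial (Fin (m + 1)) k) :=
  RingHom.ker (aeval f : MvPolynomial (Fin (m + 1)) k →ₐ[k] MvPolynomial (Fin (n + 1)) k)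

/-- The composite tuple `g(f) = (g_0(f), …, g_r(f))`. -/
def comp {k : Type*} [Field k] {n m r : ℕ}
    (g : Fin (r + 1) → MvPolynomial (Fin (m + 1)) k)
    (f : Fin (m + 1) → MvPolynomial (Fin (n + 1)) k) :
    Fin (r + 1) → MvPolynomial (Fin (n + 1)) k :=
  fun i => aeval f (g i)

/-- `g` represents an inverse of the rational map of `ℙⁿ` onto `ℙⁿ` represented by `f`: it is a
rational datum and `g(f)` is equivalent to the identity `(X_0, …, X_n)`. -/
def IsInverseDatum {k : Type*} [Field k] {n : ℕ}
    (f g : Fin (n + 1) → MvPolynomial (Fin (n + 1)) k) : Prop :=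
  (∃ e, IsRationalDatum e g) ∧ EquivTuple (comp g f) X

/-- `f` represents a Cremona map of `ℙⁿ`, that is, a birational map of `ℙⁿ` onto itself. -/
def IsCremona {k : Type*} [Field k] {n : ℕ}
    (f : Fin (n + 1) → MvPolynomial (Fin (n + 1)) k) : Prop :=
  (∃ d, IsRationalDatum d f) ∧ imageIdeal f = ⊥ ∧ ∃ g, IsInverseDatum f g

/-- The rational map represented by `f` has degree `r`: it is defined by forms of degree `r`
generating an ideal of codimension at least two. -/
def HasDegree {k : Type*} [Field k] {n m : ℕ}
    (f : Fin (m + 1) → MvPolynomial (Fin (n + 1)) k) (r : ℕ) : Prop :=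
  ∃ f', EquivTuple f f' ∧ IsRationalDatum r f' ∧ 2 ≤ (baseIdeal f').height

/-- The `R`-algebra map `R[Y_0, …, Y_m] → ℛ((f))` onto the Rees algebra `⨁ (f)^q t^q ⊆ R[t]`
sending `Y_j` to `f_j t`. -/
def reesPresentation {R ι : Type*} [CommRing R] (f : ι → R) :
    MvPolynomial ι R →ₐ[R] reesAlgebra (baseIdeal f) :=
  aeval fun j => ⟨Polynomial.monomial 1 (f j), (reesAlgebra.monomial_mem).2 (by
    rw [pow_one]; exact Ideal.subset_span ⟨j, rfl⟩)⟩

/-- The presentation ideal `𝒥` of the Rees algebra. -/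
def presentationIdeal {R ι : Type*} [CommRing R] (f : ι → R) : Ideal (MvPolynomial ι R) :=
  RingHom.ker (reesPresentation f)

/-- `Q ∈ k[X][Y]` is a form of bidegree `(p, q)`: of degree `p` in `X` and of degree `q` in `Y`. -/
def IsBihomogeneous {k σ ι : Type*} [Field k] (Q : MvPolynomial ι (MvPolynomial σ k))
    (p q : ℕ) : Prop :=
  Q.IsHomogeneous q ∧ ∀ v, (Q.coeff v).IsHomogeneous p

/-- The bigraded piece `𝒥_{1,q}` (as a set). -/
def semilinearPiece {k σ ι : Type*} [Field k] (f : ι → MvPolynomial σ k) (q : ℕ) :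
    Set (MvPolynomial ι (MvPolynomial σ k)) :=
  {Q | Q ∈ presentationIdeal f ∧ IsBihomogeneous Q 1 q}

/-- The ideal `(𝒥_{1,*})` of `k[X][Y]`. -/
def semilinearIdeal {k σ ι : Type*} [Field k] (f : ι → MvPolynomial σ k) :
    Ideal (MvPolynomial ι (MvPolynomial σ k)) :=
  Ideal.span {Q | ∃ q, Q ∈ semilinearPiece f q}

/-- The ideal `(𝒥_{1,≤s})` of `k[X][Y]`. -/
def semilinearIdealLE {k σ ι : Type*} [Field k] (f : ι → MvPolynomial σ k) (s : ℕ) :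
    Ideal (MvPolynomial ι (MvPolynomial σ k)) :=
  Ideal.span {Q | ∃ q ≤ s, Q ∈ semilinearPiece f q}

/-- The semilinear generation degree of the ideal `(f)`: the least `s ≥ 1` such that
`(𝒥_{1,*}) = (𝒥_{1,≤s})`. -/
def sgd {k σ ι : Type*} [Field k] (f : ι → MvPolynomial σ k) : ℕ :=
  sInf {s : ℕ | 1 ≤ s ∧ semilinearIdeal f = semilinearIdealLE f s}

end Cremona

end

namespace Cremona

open MvPolynomial

/-! ### Attainment of the semilinear generation degree. -/

section Sgd

variable {k σ ι : Type*} [Field k]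

/-! A form `∑ Xᵢ aᵢ(Y)` lies in `𝒥` iff `a` is a syzygy of the reduced inverse tuple `g'`: `X` is
proportional to `g(f)`, and substitution of `f` is injective (`sum_X_mul_aeval_eq_zero_iff`). Let `s
= sgd f` and `g'_j ≠ 0`. The syzygies of `g'` of degree at most `s` have rank `n` over the fraction
field, since they generate the ideal that contains the Koszul syzygies. So `n` of them, with the
basis vector `e_j` as row `j`, form a matrix `M` with `det M ≠ 0` and `M g' = g'_j e_j`
(`exists_matrix_det_ne_zero`). By Cramer, `g'_j` divides every `det M * g'_i`. As the `g'_i` have no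
common factor, `g'_j` divides `det M`, which has degree at most `n * s`. -/

theorem semilinearIdealLE_mono (f : ι → MvPolynomial σ k) : Monotone (semilinearIdealLE f) := by
  intro s t hst
  refine Ideal.span_mono ?_
  rintro Q ⟨q, hq, hQ⟩
  exact ⟨q, hq.trans hst, hQ⟩

theorem semilinearIdealLE_le (f : ι → MvPolynomial σ k) (s : ℕ) :
    semilinearIdealLE f s ≤ semilinearIdeal f := by
  refine Ideal.span_mono ?_
  rintro Q ⟨q, _, hQ⟩
  exact ⟨q, hQ⟩

/-- By noetherianity, the semilinear generation degree is attained. -/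
theorem sgd_spec [Finite σ] [Finite ι] (f : ι → MvPolynomial σ k) :
    1 ≤ sgd f ∧ semilinearIdeal f = semilinearIdealLE f (sgd f) := by
  refine Nat.sInf_mem (s := {s : ℕ | 1 ≤ s ∧ semilinearIdeal f = semilinearIdealLE f s}) ?_
  obtain ⟨N, hN⟩ := monotone_stabilizes_iff_noetherian.mpr
    (inferInstance : IsNoetherianRing (MvPolynomial ι (MvPolynomial σ k)))
    ⟨semilinearIdealLE f, semilinearIdealLE_mono f⟩
  refine ⟨max 1 N, le_max_left _ _, le_antisymm ?_ (semilinearIdealLE_le f _)⟩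
  refine Ideal.span_le.mpr ?_
  rintro Q ⟨q, hQ⟩
  have h1 : Q ∈ semilinearIdealLE f (max N q) :=
    Ideal.subset_span ⟨q, le_max_right _ _, hQ⟩
  have h2 : semilinearIdealLE f N = semilinearIdealLE f (max N q) := hN _ (le_max_left _ _)
  rw [← h2] at h1
  exact semilinearIdealLE_mono f (le_max_right _ _) h1

end Sgd

/-! ### Homogeneous elements of the presentation ideal of the Rees algebra. -/

section Rees

variable {R ι : Type*} [CommRing R]

theorem coe_reesPresentation (f : ι → R) (Q : MvPolynomial ι R) :
    (reesPresentation f Q : Polynomial R) = aeval (fun j => Polynomial.monomial 1 (f j)) Q := by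
  have : (reesAlgebra (baseIdeal f)).val.comp (reesPresentation f) =
      aeval (fun j => Polynomial.monomial 1 (f j)) := by
    ext j
    simp [reesPresentation]
  exact DFunLike.congr_fun this Q

theorem eval_coe_reesPresentation (f : ι → R) (Q : MvPolynomial ι R) :
    (reesPresentation f Q : Polynomial R).eval 1 = aeval f Q := by
  rw [coe_reesPresentation]
  have : (Polynomial.aeval (1 : R)).comp
      (aeval (fun j => Polynomial.monomial 1 (f j)) : MvPolynomial ι R →ₐ[R] Polynomial R) =
      aeval f := by
    ext j
    simp
  simpa [Polynomial.aeval_def] using DFunLike.congr_fun this Q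

/-- Only one power of `t` occurs, so for `Q` homogeneous in `Y`, membership in `𝒥` amounts to `Q(f)
= 0`. -/
theorem coe_reesPresentation_of_isHomogeneous (f : ι → R) {Q : MvPolynomial ι R} {q : ℕ}
    (hQ : Q.IsHomogeneous q) :
    (reesPresentation f Q : Polynomial R) = Polynomial.monomial q (aeval f Q) := by
  rw [coe_reesPresentation, aeval_def, aeval_def, eval₂_eq, eval₂_eq, map_sum]
  refine Finset.sum_congr rfl fun v hv => ?_
  have hv' : ∑ i ∈ v.support, v i = q := by
    have := hQ (mem_support_iff.mp hv)
    rwa [Finsupp.weight_apply, Finsupp.sum, Finset.sum_congr rfl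
      (fun i _ => by simp : ∀ i ∈ v.support, v i • (1 : ι → ℕ) i = v i)] at this
  have : ∀ S : Finset ι, ∏ i ∈ S, (Polynomial.monomial 1 (f i)) ^ v i =
      Polynomial.monomial (∑ i ∈ S, v i) (∏ i ∈ S, f i ^ v i) := by
    classical
    intro S
    induction S using Finset.induction_on with
    | empty => simp
    | insert a S ha ih =>
      rw [Finset.prod_insert ha, ih, Finset.prod_insert ha, Finset.sum_insert ha,
        Polynomial.monomial_pow, Polynomial.monomial_mul_monomial, one_mul]
  rw [this, hv']
  simp [Polynomial.C_mul_monomial]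

theorem aeval_eq_zero_of_mem_presentationIdeal {f : ι → R} {Q : MvPolynomial ι R}
    (hQ : Q ∈ presentationIdeal f) : aeval f Q = 0 := by
  rw [← eval_coe_reesPresentation, (RingHom.mem_ker.mp hQ : reesPresentation f Q = 0)]
  simp

theorem mem_presentationIdeal_of_isHomogeneous {f : ι → R} {Q : MvPolynomial ι R} {q : ℕ}
    (hQ : Q.IsHomogeneous q) (h : aeval f Q = 0) : Q ∈ presentationIdeal f := by
  refine RingHom.mem_ker.mpr (Subtype.ext ?_)
  rw [coe_reesPresentation_of_isHomogeneous f hQ, h]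
  simp

end Rees

/-! ### Forms of degree one in `X` as coefficient vectors over `k[Y]`. -/

section Linear

variable {k σ ι : Type*} [Field k] [Fintype σ]

/-- The polynomial `∑ Xᵢ aᵢ(Y)` of `k[X][Y]`. -/
noncomputable def linearCombination (a : σ → MvPolynomial ι k) : MvPolynomial ι (MvPolynomial σ k) :=
  ∑ i, C (X i) * map C (a i)

theorem coeff_linearCombination (a : σ → MvPolynomial ι k) (v : ι →₀ ℕ) :
    (linearCombination a).coeff v = ∑ i, X i * C ((a i).coeff v) := by
  simp [linearCombination, coeff_sum, coeff_C_mul, coeff_map]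

theorem isBihomogeneous_linearCombination {a : σ → MvPolynomial ι k} {q : ℕ}
    (ha : ∀ i, (a i).IsHomogeneous q) : IsBihomogeneous (linearCombination a) 1 q := by
  refine ⟨?_, fun v => ?_⟩
  · refine IsHomogeneous.sum _ _ _ fun i _ => ?_
    simpa using (isHomogeneous_C ι (X i : MvPolynomial σ k)).mul ((ha i).map C)
  · rw [coeff_linearCombination]
    refine IsHomogeneous.sum _ _ _ fun i _ => ?_
    simpa using (isHomogeneous_X k i).mul (isHomogeneous_C σ ((a i).coeff v))

theorem eval₂Hom_linearCombination {K : Type*} [CommRing K] (c : k →+* K) (w : σ → K) (y : ι → K)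
    (a : σ → MvPolynomial ι k) :
    eval₂Hom (eval₂Hom c w) y (linearCombination a) = ∑ i, w i * eval₂Hom c y (a i) := by
  simp only [linearCombination, map_sum, map_mul]
  refine Finset.sum_congr rfl fun i _ => ?_
  have h : (eval₂Hom c w).comp (C : k →+* MvPolynomial σ k) = c := by ext; simp
  simp [h]

theorem aeval_linearCombination (f : ι → MvPolynomial σ k) (a : σ → MvPolynomial ι k) :
    aeval f (linearCombination a) = ∑ i, X i * aeval f (a i) := by
  simp only [linearCombination, map_sum, map_mul]
  refine Finset.sum_congr rfl fun i _ => ?_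
  rw [aeval_C]
  congr 1
  rw [aeval_def, aeval_def, eval₂_map]
  rfl

theorem eq_sum_of_isHomogeneous_one {p : MvPolynomial σ k} (hp : p.IsHomogeneous 1) :
    p = ∑ i, X i * C (p.coeff (Finsupp.single i 1)) := by
  classical
  ext m
  simp only [coeff_sum, mul_comm (X _), coeff_C_mul, coeff_X]
  by_cases hm : m.degree = 1
  · obtain ⟨i, rfl⟩ : m ∈ Set.range (Finsupp.single · 1) := by
      rwa [Finsupp.range_single_one]
    rw [Finset.sum_eq_single i]
    · simp
    · intro b _ hb
      rw [if_neg, mul_zero]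
      exact fun h => hb (Finsupp.single_left_injective one_ne_zero h)
    · simp
  · rw [hp.coeff_eq_zero hm, eq_comm]
    refine Finset.sum_eq_zero fun i _ => ?_
    rw [if_neg, mul_zero]
    rintro rfl
    simp at hm

theorem exists_eq_linearCombination {Q : MvPolynomial ι (MvPolynomial σ k)} {q : ℕ}
    (hQ : IsBihomogeneous Q 1 q) :
    ∃ a : σ → MvPolynomial ι k, Q = linearCombination a ∧ ∀ i, (a i).IsHomogeneous q := by
  classical
  have hc : ∀ i v, (∑ u ∈ Q.support,
      monomial u ((Q.coeff u).coeff (Finsupp.single i 1))).coeff v =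
      (Q.coeff v).coeff (Finsupp.single i 1) := by
    intro i v
    rw [coeff_sum]
    simp only [coeff_monomial, Finset.sum_ite_eq']
    split_ifs with h
    · rfl
    · rw [notMem_support_iff.mp h, coeff_zero]
  refine ⟨fun i => ∑ v ∈ Q.support, monomial v ((Q.coeff v).coeff (Finsupp.single i 1)), ?_, ?_⟩
  · ext1 v
    rw [coeff_linearCombination]
    simp only [hc]
    exact eq_sum_of_isHomogeneous_one (hQ.2 v)
  · intro i v hv
    rw [hc] at hv
    exact hQ.1 (fun h => hv (by rw [h, coeff_zero]))

end Linear

/-! ### Syzygies of the inverse tuple and the degree bound. -/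

section Syzygies

variable {k σ : Type*} [Field k]

/-- If `g(f)` is proportional to `X`, and `g'` is proportional to `g`, then the relations
`∑ Xᵢ aᵢ(f) = 0` are the syzygies of `g'`. -/
theorem sum_X_mul_aeval_eq_zero_iff {n : ℕ}
    {f g g' : Fin (n + 1) → MvPolynomial (Fin (n + 1)) k}
    (hf : imageIdeal f = ⊥) (hg : EquivTuple (comp g f) X) (hg' : EquivTuple g g')
    (a : Fin (n + 1) → MvPolynomial (Fin (n + 1)) k) :
    ∑ i, X i * aeval f (a i) = 0 ↔ ∑ i, g' i * a i = 0 := by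
  obtain ⟨A, A', _, _, hA, hA', _, _, h⟩ := hg
  obtain ⟨B, B', _, _, hB, hB', _, _, h'⟩ := hg'
  have hinj : Function.Injective (aeval f : _ →ₐ[k] MvPolynomial (Fin (n + 1)) k) :=
    (RingHom.injective_iff_ker_eq_bot _).mpr hf
  have e1 : A * ∑ i, X i * aeval f (a i) = A' * aeval f (∑ i, g i * a i) := by
    simp only [Finset.mul_sum, map_sum, map_mul]
    refine Finset.sum_congr rfl fun i _ => ?_
    rw [← mul_assoc, h i, comp, mul_assoc]
  have e2 : B * ∑ i, g' i * a i = B' * ∑ i, g i * a i := by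
    simp only [Finset.mul_sum]
    refine Finset.sum_congr rfl fun i _ => ?_
    rw [← mul_assoc, h' i, mul_assoc]
  calc ∑ i, X i * aeval f (a i) = 0 ↔ aeval f (∑ i, g i * a i) = 0 := by
        rw [← mul_eq_zero_iff_left hA, e1, mul_eq_zero_iff_left hA']
    _ ↔ ∑ i, g i * a i = 0 := map_eq_zero_iff _ hinj
    _ ↔ ∑ i, g' i * a i = 0 := by
        rw [← mul_eq_zero_iff_left hB', ← e2, mul_eq_zero_iff_left hB]

/-- A divisor of all members of a family that generates an ideal of height at least two is a
unit. -/
theorem isUnit_of_forall_dvd {R ι : Type*} [CommRing R] [IsNoetherianRing R] {g : ι → R}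
    (hg : 2 ≤ (baseIdeal g).height) {q : R} (hq : ∀ i, q ∣ g i) : IsUnit q := by
  by_contra hu
  have hle : baseIdeal g ≤ Ideal.span {q} := by
    refine Ideal.span_le.mpr ?_
    rintro _ ⟨i, rfl⟩
    exact Ideal.mem_span_singleton.mpr (hq i)
  have h1 : (Ideal.span {q}).height ≤ 1 := Ideal.height_span_singleton_le_one hu
  have h2 := (hg.trans (Ideal.height_mono hle)).trans h1
  exact absurd h2 (by decide)

/-- Cancel the common part `c` of `D` and `g j`: the remaining factor `q` of `g j` is coprime to `D
/ c`, hence divides every `g i` and is a unit. So `g j` is associated to the divisor `c` of `D`. -/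
theorem totalDegree_le_of_mul_eq_mul {ι : Type*} [Finite σ] {g : ι → MvPolynomial σ k} (hg : 2 ≤ (baseIdeal g).height) {D : MvPolynomial σ k}
    (hD : D ≠ 0) {j : ι} (Δ : ι → MvPolynomial σ k) (h : ∀ i, D * g i = g j * Δ i) :
    (g j).totalDegree ≤ D.totalDegree := by
  obtain ⟨D', q, c, hc, hD', hq⟩ := UniqueFactorizationMonoid.exists_reduced_factors D hD (g j)
  have hc0 : c ≠ 0 := by rintro rfl; simp at hD'; exact hD hD'.symm
  have hD0 : D' ≠ 0 := by rintro rfl; simp at hD'; exact hD hD'.symm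
  have hu : IsUnit q := by
    refine isUnit_of_forall_dvd hg fun i => hc.symm.dvd_of_dvd_mul_left ⟨Δ i, ?_⟩
    refine mul_left_cancel₀ hc0 ?_
    rw [← mul_assoc, ← mul_assoc, hD', hq, h]
  have hq0 : q.totalDegree = 0 := by
    obtain ⟨r, hr, rfl⟩ := MvPolynomial.isUnit_iff_eq_C_of_isReduced.mp hu
    exact totalDegree_C r
  calc (g j).totalDegree ≤ c.totalDegree + q.totalDegree := hq ▸ totalDegree_mul c q
    _ ≤ c.totalDegree + D'.totalDegree := by omega
    _ = D.totalDegree := by rw [← hD', totalDegree_mul_of_isDomain hc0 hD0]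

/-- Each term of the Leibniz expansion takes one entry from each row. -/
theorem totalDegree_det_le {R σ m : Type*} [CommRing R] [Fintype m] [DecidableEq m]
    (N : Matrix m m (MvPolynomial σ R)) (d : m → ℕ) (h : ∀ i j, (N i j).totalDegree ≤ d i) :
    N.det.totalDegree ≤ ∑ i, d i := by
  rw [Matrix.det_apply]
  refine totalDegree_finsetSum_le fun τ _ => ?_
  refine (totalDegree_smul_le _ _).trans ((totalDegree_finsetProd _ _).trans ?_)
  exact (Finset.sum_le_sum fun i _ => h (τ i) i).trans_eq (Equiv.sum_comp τ d)

/-- If no nonzero vector with vanishing `j`-th coordinate is orthogonal to `S`, then the standard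
basis vector `e_j` can be completed by members of `S` to the rows of an invertible matrix. -/
theorem exists_matrix_det_ne_zero {K m : Type*} [Field K] [Fintype m] [DecidableEq m]
    (S : Set (m → K)) (j : m)
    (hS : ∀ w : m → K, w j = 0 → (∀ a ∈ S, ∑ i, w i * a i = 0) → w = 0) :
    ∃ N : Matrix m m K, N j = Pi.single j 1 ∧ (∀ i, i ≠ j → N i ∈ S) ∧ N.det ≠ 0 := by
  classical
  have htop : Submodule.span K (insert (Pi.single j 1) S) = ⊤ := by
    by_contra hne
    -- If the span were proper, a nonzero functional would kill it; its coordinate vector is a `w`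
    -- excluded by `hS`.
    obtain ⟨φ, hφ0, hφ⟩ := Submodule.exists_le_ker_of_lt_top _ (lt_top_iff_ne_top.mpr hne)
    have hφw : ∀ a, φ a = ∑ i, φ (Pi.single i 1) * a i := by
      intro a
      conv_lhs => rw [← Finset.univ_sum_single a]
      rw [map_sum]
      refine Finset.sum_congr rfl fun i _ => ?_
      have : (Pi.single i (a i) : m → K) = a i • Pi.single i 1 := by
        rw [← Pi.single_smul, smul_eq_mul, mul_one]
      rw [this, map_smul, smul_eq_mul, mul_comm]
    have hw := hS (fun i => φ (Pi.single i 1))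
      (hφ (Submodule.subset_span (Set.mem_insert _ _)))
      (fun a ha => (hφw a).symm.trans
        (hφ (Submodule.subset_span (Set.mem_insert_of_mem _ ha))))
    refine hφ0 (LinearMap.ext fun a => ?_)
    rw [hφw]
    simp [fun i => congrFun hw i]
  have hj : LinearIndepOn K id ({Pi.single j 1} : Set (m → K)) :=
    LinearIndepOn.singleton (by simp)
  obtain ⟨b, hbS, hjb, hspan, hb⟩ := exists_linearIndepOn_id_extension hj
    (Set.singleton_subset_iff.mpr (Set.mem_insert (Pi.single j 1) S))
  have hbtop : ⊤ ≤ Submodule.span K (Set.range ((↑) : b → m → K)) := by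
    rw [Subtype.range_coe, ← htop]
    exact Submodule.span_le.mpr hspan
  let B : Module.Basis b K (m → K) := Module.Basis.mk hb hbtop
  let ε₀ : m ≃ b := (Pi.basisFun K m).indexEquiv B
  -- The swap makes index `j` correspond to `e_j`.
  let ε : m ≃ b := ε₀.trans (Equiv.swap (ε₀ j) ⟨Pi.single j 1, hjb rfl⟩)
  have hεj : (ε j : m → K) = Pi.single j 1 := by simp [ε]
  refine ⟨Matrix.of fun i => (ε i : m → K), hεj, fun i hij => ?_, ?_⟩
  · refine (hbS (ε i).2).resolve_left fun h => hij (ε.injective (Subtype.ext ?_))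
    rw [h, hεj]
  · have hli : LinearIndependent K fun i => (ε i : m → K) := hb.comp ε ε.injective
    have := Matrix.linearIndependent_rows_iff_isUnit (A := Matrix.of fun i => (ε i : m → K))
    exact ((Matrix.isUnit_iff_isUnit_det _).mp (this.mp hli)).ne_zero

/-- The inverse of a Cremona map has degree at most `n` times a degree in which the semilinear
relations are generated. -/
theorem degree_inverse_le {n s e : ℕ} {f g g' : Fin (n + 1) → MvPolynomial (Fin (n + 1)) k}
    (hf : imageIdeal f = ⊥) (hg : EquivTuple (comp g f) X) (hgg' : EquivTuple g g')
    (hg' : IsRationalDatum e g') (hht : 2 ≤ (baseIdeal g').height)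
    (hs : semilinearIdeal f = semilinearIdealLE f s) : e ≤ n * s := by
  classical
  obtain ⟨j, hj⟩ : ∃ j, g' j ≠ 0 := by
    by_contra! h
    refine hg'.baseIdeal_ne_bot (Ideal.span_eq_bot.mpr ?_)
    rintro _ ⟨i, rfl⟩
    exact h i
  let P := MvPolynomial (Fin (n + 1)) k
  let K := FractionRing P
  have hinj : Function.Injective (algebraMap P K) := IsFractionRing.injective P K
  have hsyz := sum_X_mul_aeval_eq_zero_iff hf hg hgg'
  let S : Set (Fin (n + 1) → P) :=
    {a | (∀ i, (a i).totalDegree ≤ s) ∧ ∑ i, g' i * a i = 0}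
  obtain ⟨N, hNj, hNS, hN⟩ := exists_matrix_det_ne_zero
      ((fun a i => algebraMap P K (a i)) '' S) j (by
    intro w hwj hw
    let y : Fin (n + 1) → K := fun i => algebraMap P K (X i)
    -- Substituting `w` for `X` and keeping `Y` turns orthogonality to `S` into the vanishing of all
    -- semilinear relations, by generation in degrees at most `s`.
    let θ := eval₂Hom (eval₂Hom ((algebraMap P K).comp C) w) y
    have hθ : ∀ a, θ (linearCombination a) = ∑ i, w i * algebraMap P K (a i) := by
      intro a
      rw [eval₂Hom_linearCombination]
      have : eval₂Hom ((algebraMap P K).comp C) y = algebraMap P K := by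
        ext <;> simp [y, P]
      rw [this]
    have hker : semilinearIdeal f ≤ RingHom.ker θ := by
      rw [hs]
      refine Ideal.span_le.mpr ?_
      rintro Q ⟨q, hq, hQ, hQ'⟩
      obtain ⟨a, rfl, ha⟩ := exists_eq_linearCombination hQ'
      have h0 := aeval_eq_zero_of_mem_presentationIdeal hQ
      rw [aeval_linearCombination, hsyz] at h0
      exact RingHom.mem_ker.mpr ((hθ a).trans
        (hw _ ⟨a, ⟨fun i => (ha i).totalDegree_le.trans hq, h0⟩, rfl⟩))
    funext l
    -- The Koszul syzygy on `g'_j` and `g'_l`; since `w j = 0`, applying `θ` leaves `w l * g'_j =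
    -- 0`.
    let a : Fin (n + 1) → P := Pi.single l (g' j) - Pi.single j (g' l)
    have ha : ∀ i, (a i).IsHomogeneous e := by
      intro i
      refine IsHomogeneous.sub ?_ ?_
      · rw [Pi.single_apply]
        split_ifs
        exacts [hg'.homogeneous j, isHomogeneous_zero _ _ _]
      · rw [Pi.single_apply]
        split_ifs
        exacts [hg'.homogeneous l, isHomogeneous_zero _ _ _]
    have hmem : linearCombination a ∈ semilinearIdeal f := by
      have hbi := isBihomogeneous_linearCombination ha
      refine Ideal.subset_span ⟨e, mem_presentationIdeal_of_isHomogeneous hbi.1 ?_, hbi⟩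
      rw [aeval_linearCombination, hsyz]
      simp [a, mul_sub, Pi.single_apply, Finset.sum_sub_distrib, mul_comm]
    have h0 : θ (linearCombination a) = 0 := hker hmem
    rw [hθ] at h0
    have h1 : w l * algebraMap P K (g' j) = 0 := by
      simpa [a, mul_sub, Pi.single_apply, Finset.sum_sub_distrib, apply_ite (algebraMap P K),
        hwj] using h0
    exact (mul_eq_zero.mp h1).resolve_right ((map_ne_zero_iff _ hinj).mpr hj))
  choose! a haS ha using hNS
  let M : Matrix (Fin (n + 1)) (Fin (n + 1)) P :=
    Matrix.of fun i => if i = j then Pi.single j 1 else a i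
  have hMN : M.map (algebraMap P K) = N := by
    ext i l
    by_cases hij : i = j
    · subst hij
      rw [hNj]
      simp [M, Pi.single_apply, apply_ite (algebraMap P K)]
    · simp [M, hij, ← ha i hij]
  have hD : M.det ≠ 0 := by
    intro h
    refine hN ?_
    rw [← hMN, ← RingHom.mapMatrix_apply, ← RingHom.map_det, h, map_zero]
  have hMg : M.mulVec g' = Pi.single j (g' j) := by
    funext i
    by_cases hij : i = j
    · subst hij
      simp [M, Matrix.mulVec, dotProduct, Pi.single_apply]
    · rw [Pi.single_eq_of_ne hij, ← (haS i hij).2]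
      simp [M, Matrix.mulVec, dotProduct, hij, mul_comm]
  have hcramer : ∀ i, M.det * g' i = g' j * M.adjugate i j := by
    intro i
    have h := congrFun (congrArg (M.adjugate.mulVec) hMg) i
    rw [Matrix.mulVec_mulVec, Matrix.adjugate_mul, Matrix.smul_mulVec, Matrix.one_mulVec] at h
    simpa [mul_comm] using h
  have hdeg : M.det.totalDegree ≤ n * s := by
    -- Row `j` is constant, so only `n` of the `n + 1` rows contribute `s`.
    refine (totalDegree_det_le M (fun i => if i = j then 0 else s) fun i l => ?_).trans ?_
    · by_cases hij : i = j
      · simp [M, hij, Pi.single_apply, apply_ite totalDegree]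
      · simpa [M, hij] using (haS i hij).1 l
    · rw [Finset.sum_ite, Finset.filter_ne']
      simp
  calc e = (g' j).totalDegree := ((hg'.homogeneous j).totalDegree hj).symm
    _ ≤ M.det.totalDegree := totalDegree_le_of_mul_eq_mul hht hD _ hcramer
    _ ≤ n * s := hdeg

end Syzygies

end Cremona

theorem mainTheorem11 {k : Type*} [Field k] (n : ℕ) (hn : 1 ≤ n)
    (f g : Fin (n + 1) → MvPolynomial (Fin (n + 1)) k)
    (hf : Cremona.IsCremona f) (hg : Cremona.IsInverseDatum f g)
    (e : ℕ) (he : Cremona.HasDegree g e) :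
    (e : ℚ) / (n : ℚ) ≤ (Cremona.sgd f : ℚ) := by
  obtain ⟨g', hgg', hg', hht⟩ := he
  have h := Cremona.degree_inverse_le hf.2.1 hg.2 hgg' hg' hht (Cremona.sgd_spec f).2
  rw [div_le_iff₀ (by exact_mod_cast hn), mul_comm]
  exact_mod_cast h
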